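/- **Setting.** Let $q_j=\sum_{a=1}^{L}a_{ja}k_a+r_j$, $r_j=\sum_{i=1}^{n}b_{ji}p_i$ $(1\le j\le p)$, with $a_{ja},b_{ji}\in\{-1,0,1\}$, be the momenta of $p$ propagators. Here $k_1,\dots,k_L$ are the loop momenta, which are independent (the $p\times L$ matrix $(a_{ja})$ has rank $L$), and $p_1,\dots,p_n$ are real Minkowski vectors (signature $(+,-,\dots,-)$), the independent external momenta ($n=E-1$). Put $A(\alpha)_{ab}=\sum_j\alpha_ja_{ja}a_{jb}$, $v_a=\sum_j\alpha_ja_{ja}r_j$ and $$\mathcal U(\alpha)=\det A(\alpha),\qquad \widetilde{\mathcal F}(\alpha)=\sum_{a,b}\operatorname{adj}(A)_{ab}\,v_a\cdot v_b-\mathcal U\sum_j\alpha_j r_j^2,\qquad \mathcal F(\alpha;x)=\mathcal U(\alpha)\sum_j m_j^2\alpha_j+\widetilde{\mathcal F}(\alpha),$$ where $x=((p_i\cdot p_k)_{i,k},m_1^2,\dots,m_p^2)$ are the external scales. **The Feynman integral.** For $\nu\in\mathbb C^p$, $D\in\mathbb C$, complex squared masses and $\theta\in[0,\pi/2]$ let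 $$S_\theta(x;\nu;D)=e^{i\theta(\sum_j\nu_j-LD/2)}\int_{(0,\infty)^p}\prod_{j=1}^p\frac{\alpha_j^{\nu_j-1}d\alpha_j}{\Gamma(\nu_j)}\;\mathcal U(\alpha)^{-D/2}\exp\!\big(-e^{i\theta}\mathcal F(\alpha;x)/\mathcal U(\alpha)\big)$$ be the Schwinger integral along the ray $e^{i\theta}\mathbb R_+$ ($\theta=0$ is the usual one). It is used for those masses for which $\operatorname{Re}(e^{i\theta}\mathcal F/\mathcal U)\ge c\sum_j\alpha_j$ on $(0,\infty)^p$ for some $c>0$. Let $\mathcal M$ be the set of all $(m_j^2)_j\in\mathbb C^p$ with this property for some $\theta\in[0,\pi/2]$; it contains all masses with $\operatorname{Im}m_j^2<0$ for all $j$. Let $S(x;\nu;D)$ be the continuation of these integrals from large $\operatorname{Re}\nu_j$ and $-\operatorname{Re}D$: a quotient $N/h$ on a region $\{\operatorname{Re}\nu_j>b_j,\ \operatorname{Re}D<c\}$, where $N$ is analytic in $(m^2,\nu,D)$ for $m^2\in\mathcal M$ and $h$ is analytic in $(\nu,D)$. We call $(\nu,D)$ *regular* if some such continuation exists around it with $h(\nu,D)\ne0$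 (the dimensionally regularised integral is finite there). For $\nu\in\mathbb Z^p$ and $D=D_0-2\epsilon$ with $D_0\in\mathbb Z$, $\epsilon\in\mathbb C$, put $$I(x;\nu;D)=e^{\gamma_EL\epsilon}S(x;\nu;D)\quad (m^2\in\mathcal M),\qquad I(x;\nu;D)=\lim_{\eta\to0^+}I(x;\nu;D)\big|_{m_j^2\to m_j^2-i\eta}\quad(\text{real squared masses}).$$ The shift $D\to D-2$ means $D_0\to D_0-2$ with $\epsilon$ fixed. Real squared masses $m^2$ are *generic* (for $\nu$, $D$) if they are not a singular point of $I$: the holomorphic function $I(\cdot;\nu;D)$ on $\{\operatorname{Im}m_j^2<0\ \forall j\}$ continues analytically to a neighbourhood of $m^2$. **Proposition.** Let $\nu\in\mathbb Z^p$ and $D=D_0-2\epsilon$ be such that $(\nu,D)$ is regular. Then: 1. $(\nu,D-2)$ is regular. 2. All positive squared masses in $\mathcal M$ are generic. 3. If the squared masses are positive and generic, then the limits defining $I(\cdot;\nu;D)$ and $I(\cdot;\nu;D-2)$ exist for all real squared masses near $m^2$, both functions are real analytic at $m^2$, and $$I(x;\nu;D-2)=(-1)^L\,\mathcal U\!\left(\frac{\partial}{\partial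 m_1^2},\dots,\frac{\partial}{\partial m_p^2}\right)I(x;\nu;D),$$ where the derivatives are taken in $m_1^2,\dots,m_p^2$ as independent variables, at fixed external momenta. -/

import Mathlib

open Filter Topology MeasureTheory
open scoped BigOperators

noncomputable section

namespace Feynman

/-- Minkowski product of signature `(+,-,…,-)` on `ℝ^{1+d}`. -/
def minkowski {d : ℕ} (v w : Fin (d + 1) → ℝ) : ℝ :=
  v 0 * w 0 - ∑ i : Fin d, v i.succ * w i.succ

/-- The external scales `s i k = p_i · p_k` of the independent external momenta. -/
def scales {d n : ℕ} (P : Fin n → Fin (d + 1) → ℝ) : Matrix (Fin n) (Fin n) ℝ :=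
  fun i k => minkowski (P i) (P k)

/-- Momentum routing of a family of Feynman integrals with `p` propagators, `L` loop momenta `k_a`
and `n = E - 1` independent external momenta `p_i` (the last external momentum is `-∑ p_i`).
The momentum through the propagator `j` is `q_j = ∑ a, loop j a • k_a + ∑ i, ext j i • p_i`,
with coefficients in `{-1, 0, 1}`; the `L` loop momenta are independent. -/
structure Family (p L n : ℕ) where
  loop : Fin p → Fin L → SignType
  ext : Fin p → Fin n → SignType
  loop_indep : LinearIndependent ℝ (fun (a : Fin L) (j : Fin p) => ((loop j a : SignType) : ℝ))

namespace Family

variable {p L n : ℕ} (Γ : Family p L n)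

/-- The `L × L` matrix `A(α)` of the quadratic form `∑ j, α_j q_j²` in the loop momenta. -/
def loopMatrix : Matrix (Fin L) (Fin L) (MvPolynomial (Fin p) ℝ) :=
  fun a b => ∑ j, MvPolynomial.C ((Γ.loop j a : ℝ) * (Γ.loop j b : ℝ)) * MvPolynomial.X j

/-- The first Symanzik polynomial `𝒰(α) = det A(α)`. -/
def symanzikU : MvPolynomial (Fin p) ℝ := Γ.loopMatrix.det

/-- The product `r_j · r_l`, where `r_j = ∑ i, ext j i • p_i` is the external part of `q_j`. -/
def extProd (s : Matrix (Fin n) (Fin n) ℝ) (j l : Fin p) : ℝ :=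
  ∑ i, ∑ k, (Γ.ext j i : ℝ) * (Γ.ext l k : ℝ) * s i k

/-- The product `v_a · v_b`, where `v_a = ∑ j, α_j (loop j a) r_j` is the coefficient of `2 k_a` in
`∑ j, α_j q_j²`. -/
def linProd (s : Matrix (Fin n) (Fin n) ℝ) (a b : Fin L) : MvPolynomial (Fin p) ℝ :=
  ∑ j, ∑ l, MvPolynomial.C ((Γ.loop j a : ℝ) * (Γ.loop l b : ℝ) * Γ.extProd s j l) *
    (MvPolynomial.X j * MvPolynomial.X l)

/-- The second Symanzik polynomial (the mass independent part of `ℱ`): completing the square in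
`∑ j, α_j (m_j² - q_j²)` gives `𝒰⁻¹ ℱ̃ = vᵀ A⁻¹ v - ∑ j, α_j r_j²` besides `∑ j, α_j m_j²`. -/
def symanzikF (s : Matrix (Fin n) (Fin n) ℝ) : MvPolynomial (Fin p) ℝ :=
  (∑ a, ∑ b, Γ.loopMatrix.adjugate a b * Γ.linProd s a b) -
    Γ.symanzikU * ∑ j, MvPolynomial.C (Γ.extProd s j j) * MvPolynomial.X j

/-- `ℱ(α; x) = 𝒰(α) ∑ j, m_j² α_j + ℱ̃(α; x)`. The argument `m` lists the squared masses. -/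
def fullF (s : Matrix (Fin n) (Fin n) ℝ) (m : Fin p → ℂ) (α : Fin p → ℝ) : ℂ :=
  (MvPolynomial.eval α Γ.symanzikU : ℂ) * ∑ j, m j * (α j : ℂ) +
    (MvPolynomial.eval α (Γ.symanzikF s) : ℂ)

/-- The Schwinger integral along the ray `e^{iθ} (0,∞)` in all Schwinger parameters, without the
factor `e^{γ_E L ε}`:
`∏ j ∫ dα_j α_j^{ν_j - 1} / Γ(ν_j) 𝒰(α)^{-D/2} e^{-ℱ(α; x)/𝒰(α)}`
with `α` replaced by `e^{iθ} α`. The usual Schwinger integral has `θ = 0`;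
`θ = π/2` is the form that goes with the replacement of `m_j²` by `m_j² - iε`. -/
def schwinger (s : Matrix (Fin n) (Fin n) ℝ) (θ : ℝ) (m ν : Fin p → ℂ) (D : ℂ) : ℂ :=
  Complex.exp (Complex.I * θ * (∑ j, ν j - L * D / 2)) *
    ∫ α in {α : Fin p → ℝ | ∀ j, 0 < α j},
      (∏ j, (α j : ℂ) ^ (ν j - 1) / Complex.Gamma (ν j)) *
        (MvPolynomial.eval α Γ.symanzikU : ℂ) ^ (-D / 2) *
        Complex.exp (-(Complex.exp (Complex.I * θ) *
          (Γ.fullF s m α / (MvPolynomial.eval α Γ.symanzikU : ℂ))))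

/-- Complex squared masses for which the exponential in the Schwinger integral along the ray of
angle `θ` decays. For `θ = π/2` this contains all `m` with negative imaginary parts. -/
def decayMasses (s : Matrix (Fin n) (Fin n) ℝ) (θ : ℝ) : Set (Fin p → ℂ) :=
  {m | ∃ c : ℝ, 0 < c ∧ ∀ α : Fin p → ℝ, (∀ j, 0 < α j) →
    c * ∑ j, α j ≤ (Complex.exp (Complex.I * θ) *
      (Γ.fullF s m α / (MvPolynomial.eval α Γ.symanzikU : ℂ))).re}

/-- The complex squared masses for which some ray between `ℝ₊` and `i ℝ₊` can be used. -/
def schwingerMasses (s : Matrix (Fin n) (Fin n) ℝ) : Set (Fin p → ℂ) :=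
  {m | ∃ θ ∈ Set.Icc (0 : ℝ) (Real.pi / 2), m ∈ Γ.decayMasses s θ}

/-- A meromorphic continuation `num / den` of the Schwinger integral in the exponents `ν ∈ ℂᵖ` and
the dimension `D ∈ ℂ`, to a region `Re ν_j > lo_j`, `Re D < hi`. It is analytic in the masses, its
polar locus does not depend on them, and it agrees with the Schwinger integral for large `Re ν_j` and
`-Re D`, where that integral converges absolutely. -/
structure Continuation (s : Matrix (Fin n) (Fin n) ℝ) where
  lo : Fin p → ℝ
  hi : ℝ
  num : (Fin p → ℂ) × (Fin p → ℂ) × ℂ → ℂ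
  den : (Fin p → ℂ) × ℂ → ℂ
  num_analytic : AnalyticOnNhd ℂ num
    (Γ.schwingerMasses s ×ˢ {w | (∀ j, lo j < (w.1 j).re) ∧ w.2.re < hi})
  den_analytic : AnalyticOnNhd ℂ den {w | (∀ j, lo j < (w.1 j).re) ∧ w.2.re < hi}
  agree : ∃ B : ℝ, 0 ≤ B ∧ ∀ θ ∈ Set.Icc (0 : ℝ) (Real.pi / 2), ∀ m ∈ Γ.decayMasses s θ,
    ∀ ν : Fin p → ℂ, ∀ D : ℂ, (∀ j, lo j < (ν j).re ∧ B < (ν j).re) → D.re < hi → D.re < -B →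
      num (m, ν, D) = den (ν, D) * Γ.schwinger s θ m ν D

/-- `(ν, D)` lies in the region of the continuation, off its polar locus. -/
def Continuation.RegularAt {s : Matrix (Fin n) (Fin n) ℝ} {Γ : Family p L n}
    (C : Γ.Continuation s) (ν : Fin p → ℂ) (D : ℂ) : Prop :=
  (∀ j, C.lo j < (ν j).re) ∧ D.re < C.hi ∧ C.den (ν, D) ≠ 0

/-- The dimensionally regularised integral is finite at `(ν, D)`. -/
def IsRegular (s : Matrix (Fin n) (Fin n) ℝ) (ν : Fin p → ℂ) (D : ℂ) : Prop :=
  ∃ C : Γ.Continuation s, C.RegularAt ν D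

open Classical in
/-- The value at `(ν, D)` of the meromorphically continued Schwinger integral. By the identity
theorem it does not depend on the continuation, for `m ∈ schwingerMasses`. -/
def continued (s : Matrix (Fin n) (Fin n) ℝ) (m ν : Fin p → ℂ) (D : ℂ) : ℂ :=
  if h : Γ.IsRegular s ν D then h.choose.num (m, ν, D) / h.choose.den (ν, D) else 0

/-- The Feynman integral `I(x; ν; D)` at complex squared masses, in `D = D₀ - 2 ε` dimensions. -/
def integralC (s : Matrix (Fin n) (Fin n) ℝ) (ν : Fin p → ℤ) (D₀ : ℤ) (ε : ℂ)
    (m : Fin p → ℂ) : ℂ :=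
  Complex.exp (Real.eulerMascheroniConstant * L * ε) *
    Γ.continued s m (fun j => (ν j : ℂ)) (D₀ - 2 * ε)

/-- The squared masses `m_j² - i η` of the Feynman prescription. -/
def shifted (m : Fin p → ℝ) (η : ℝ) : Fin p → ℂ := fun j => (m j : ℂ) - Complex.I * η

/-- The Feynman integral `I(x; ν; D)`, `D = D₀ - 2 ε`, as a function of the real squared masses,
with the Feynman prescription `m_j² - i0`. -/
def integral (s : Matrix (Fin n) (Fin n) ℝ) (ν : Fin p → ℤ) (D₀ : ℤ) (ε : ℂ)
    (m : Fin p → ℝ) : ℂ :=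
  limUnder (𝓝[>] (0 : ℝ)) (fun η : ℝ => Γ.integralC s ν D₀ ε (shifted m η))

/-- Generic real squared masses: they do not lie on a singularity of `I(·; ν; D)`, that is,
the holomorphic function `I(·; ν; D)` on `{Im m_j² < 0}` continues analytically to a neighbourhood
of `m`. -/
def GenericMasses (s : Matrix (Fin n) (Fin n) ℝ) (ν : Fin p → ℤ) (D₀ : ℤ) (ε : ℂ)
    (m : Fin p → ℝ) : Prop :=
  ∃ g : (Fin p → ℂ) → ℂ, AnalyticAt ℂ g (fun j => (m j : ℂ)) ∧
    ∀ᶠ z in 𝓝[{z : Fin p → ℂ | ∀ j, (z j).im < 0}] (fun j => (m j : ℂ)),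
      Γ.integralC s ν D₀ ε z = g z

end Family

/-- The partial derivative in the variable `j`. -/
def pderiv {p : ℕ} (j : Fin p) (f : (Fin p → ℝ) → ℂ) : (Fin p → ℝ) → ℂ :=
  fun x => lineDeriv ℝ f x (Pi.single j 1)

/-- The iterated partial derivative `∂_1^{e_1} ⋯ ∂_p^{e_p} f`. -/
def monomialDeriv {p : ℕ} (e : Fin p →₀ ℕ) (f : (Fin p → ℝ) → ℂ) : (Fin p → ℝ) → ℂ :=
  (List.finRange p).foldr (fun j g => (pderiv j)^[e j] g) f

/-- The differential operator `Q(∂_1, …, ∂_p)` with constant coefficients. -/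
def diffOp {p : ℕ} (Q : MvPolynomial (Fin p) ℝ) (f : (Fin p → ℝ) → ℂ) : (Fin p → ℝ) → ℂ :=
  fun x => ∑ e ∈ Q.support, ((Q.coeff e : ℝ) : ℂ) * monomialDeriv e f x

end Feynman

end

/-! The exponent `ℱ/𝒰` is affine in the squared masses, with coefficient `α_j` at `m_j²`. Each
`∂/∂m_j²` therefore brings down `-e^{iθ} α_j`, and `𝒰(∂)` brings down `𝒰(-e^{iθ} α) = (-1)^L e^{iθL}
𝒰(α)`, since `𝒰` is homogeneous of degree `L`. The factor `𝒰(α)` turns `𝒰^{-D/2}` into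
`𝒰^{-(D-2)/2}`, and the phase is exactly the change of the prefactor under `D → D - 2`. This is
`polyDeriv_schwinger`, valid where the integral converges well.

The relation passes to continuations because the denominator does not depend on the masses:
`Continuation.lower` applies `(-1)^L 𝒰(∂)` to the numerator and shifts `D` in both parts, so
regularity at `D` gives regularity at `D - 2`. By the identity theorem (`Continuation.num_mul_den`)
the value does not depend on the continuation, which gives the relation on `schwingerMasses`
(`integralC_lower`).

At generic real masses, an analytic extension `g` of `I(·; D)` yields the extension `(-1)^L 𝒰(∂) g`
of `I(·; D - 2)`. The limits `η → 0⁺` are the restrictions of these extensions to real masses, where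
real and complex partial derivatives agree. -/

noncomputable section

namespace Feynman

/-! ### Constant-coefficient differential operators and changes of variables. -/

section DirectionalDerivatives

/-- The directional derivative along the vector `v`, as an operator on functions. -/
def dirDeriv (𝕜 : Type*) [NontriviallyNormedField 𝕜] [NormedAlgebra 𝕜 ℂ] {E : Type*}
    [AddCommGroup E] [Module 𝕜 E] (v : E) (f : E → ℂ) : E → ℂ :=
  fun x => lineDeriv 𝕜 f x v

/-- The composition of operators `T₁^{e_1} ∘ ⋯ ∘ T_p^{e_p}`. -/
def opMonomial {p : ℕ} {β : Type*} (T : Fin p → β → β) (e : Fin p →₀ ℕ) (f : β) : β :=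
  (List.finRange p).foldr (fun j g => (T j)^[e j] g) f

/-- The differential operator `Q(∂_{b 1}, …, ∂_{b p})` along the vectors `b j`. -/
def polyDeriv (𝕜 : Type*) [NontriviallyNormedField 𝕜] [NormedAlgebra 𝕜 ℂ] {E : Type*}
    [AddCommGroup E] [Module 𝕜 E] {p : ℕ} (b : Fin p → E) (Q : MvPolynomial (Fin p) ℝ)
    (f : E → ℂ) : E → ℂ :=
  fun x => ∑ e ∈ Q.support, ((Q.coeff e : ℝ) : ℂ) *
    opMonomial (fun j => dirDeriv 𝕜 (b j)) e f x

theorem diffOp_eq_polyDeriv {p : ℕ} (Q : MvPolynomial (Fin p) ℝ) (f : (Fin p → ℝ) → ℂ) :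
    diffOp Q f = polyDeriv ℝ (fun j => Pi.single j 1) Q f :=
  rfl

/-- The one induction over iterated derivatives: analyticity, changes of variables and the passage
from derivatives to weights are all instances for a suitable `R`. -/
theorem opMonomial_rel {p : ℕ} {β γ : Type*} (R : β → γ → Prop) {T : Fin p → β → β}
    {S : Fin p → γ → γ} (h : ∀ j f g, R f g → R (T j f) (S j g)) (e : Fin p →₀ ℕ) {f : β} {g : γ}
    (hfg : R f g) : R (opMonomial T e f) (opMonomial S e g) := by
  have iter : ∀ (j : Fin p) (k : ℕ) f g, R f g → R ((T j)^[k] f) ((S j)^[k] g) := by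
    intro j k
    induction k with
    | zero => exact fun f g hfg => hfg
    | succ k ih => exact fun f g hfg => ih _ _ (h j f g hfg)
  unfold opMonomial
  induction List.finRange p with
  | nil => exact hfg
  | cons j l ih => exact iter j _ _ _ ih

theorem opMonomial_mul {p : ℕ} {β R : Type*} [CommMonoid R] (u : Fin p → β → R) (e : Fin p →₀ ℕ)
    (w : β → R) :
    opMonomial (fun j w a => u j a * w a) e w = fun a => (∏ j, u j a ^ e j) * w a := by
  have iter : ∀ (j : Fin p) (k : ℕ) (w : β → R),
      (fun (w : β → R) a => u j a * w a)^[k] w = fun a => u j a ^ k * w a := by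
    intro j k w
    induction k with
    | zero => simp
    | succ k ih =>
      rw [Function.iterate_succ_apply', ih]
      funext a
      rw [pow_succ', mul_assoc]
  unfold opMonomial
  have : ∀ l : List (Fin p), l.foldr (fun j g => (fun (w : β → R) a => u j a * w a)^[e j] g) w =
      fun a => (l.map fun j => u j a ^ e j).prod * w a := by
    intro l
    induction l with
    | nil => simp
    | cons j l ih =>
      rw [List.foldr_cons, ih, iter]
      funext a
      simp [mul_assoc]
  rw [this]
  funext a
  rw [Fin.prod_univ_def]

variable {E : Type*} [NormedAddCommGroup E] [NormedSpace ℂ E]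

theorem _root_.AnalyticAt.dirDeriv {f : E → ℂ} {x : E} (hf : AnalyticAt ℂ f x) (v : E) :
    AnalyticAt ℂ (dirDeriv ℂ v f) x := by
  have h : AnalyticAt ℂ (fun y => fderiv ℂ f y v) x :=
    ((ContinuousLinearMap.apply ℂ ℂ v).analyticAt _).comp hf.fderiv
  refine h.congr ?_
  filter_upwards [hf.eventually_analyticAt] with y hy
  exact (hy.differentiableAt.lineDeriv_eq_fderiv).symm

theorem _root_.AnalyticAt.polyDeriv {p : ℕ} {f : E → ℂ} {x : E} (hf : AnalyticAt ℂ f x)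
    (b : Fin p → E) (Q : MvPolynomial (Fin p) ℝ) : AnalyticAt ℂ (polyDeriv ℂ b Q f) x := by
  unfold Feynman.polyDeriv
  refine Finset.analyticAt_fun_sum _ fun e _ => analyticAt_const.mul ?_
  exact opMonomial_rel (fun f (_ : Unit) => AnalyticAt ℂ f x) (S := fun _ _ => ())
    (fun j f _ hf => hf.dirDeriv (b j)) e (g := ()) hf

variable {𝕜 : Type*} [NontriviallyNormedField 𝕜] [NormedAlgebra 𝕜 ℂ]
  {E' : Type*} [NormedAddCommGroup E'] [NormedSpace 𝕜 E']

/-- Chain rule along a line that `φ` maps affinely. It serves both the slices `z ↦ (z, ν, D)` over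
`ℂ` and the inclusion of real masses over `ℝ`. Equality of germs, not of values, lets it be
iterated. -/
theorem dirDeriv_comp {φ : E' → E} (hφ : Continuous φ) {v' : E'} {v : E}
    (hv : ∀ y (t : 𝕜), φ (y + t • v') = φ y + algebraMap 𝕜 ℂ t • v) {c : ℂ} {f : E → ℂ}
    {g : E' → ℂ} {x : E'} (hf : AnalyticAt ℂ f (φ x)) (hg : g =ᶠ[𝓝 x] fun y => c * f (φ y)) :
    dirDeriv 𝕜 v' g =ᶠ[𝓝 x] fun y => c * dirDeriv ℂ v f (φ y) := by
  filter_upwards [eventually_eventually_nhds.2 hg,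
    hφ.continuousAt.eventually hf.eventually_analyticAt] with y hy hfy
  have h1 : HasDerivAt (fun t : ℂ => f (φ y + t • v)) (lineDeriv ℂ f (φ y) v)
      (algebraMap 𝕜 ℂ 0) := by
    rw [map_zero]
    exact hfy.differentiableAt.lineDifferentiableAt.hasLineDerivAt
  have h2 : HasDerivAt (algebraMap 𝕜 ℂ) (1 : ℂ) (0 : 𝕜) := by
    have := (algebraMapCLM 𝕜 ℂ).hasDerivAt (x := (0 : 𝕜))
    rwa [algebraMapCLM_apply, map_one] at this
  have h3 := (HasDerivAt.scomp (𝕜 := 𝕜) (𝕜' := ℂ) (0 : 𝕜) h1 h2).const_mul c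
  have hy' : g =ᶠ[𝓝 y] fun y => c * f (φ y) := hy
  unfold dirDeriv
  rw [hy'.lineDeriv_eq]
  unfold lineDeriv at h3 ⊢
  simp only [hv]
  simpa [Function.comp_def] using h3.deriv

theorem polyDeriv_comp {p : ℕ} {φ : E' → E} (hφ : Continuous φ) {b' : Fin p → E'} {b : Fin p → E}
    (hb : ∀ j y (t : 𝕜), φ (y + t • b' j) = φ y + algebraMap 𝕜 ℂ t • b j) {c : ℂ} {f : E → ℂ}
    {g : E' → ℂ} {x : E'} (hf : AnalyticAt ℂ f (φ x)) (hg : g =ᶠ[𝓝 x] fun y => c * f (φ y))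
    (Q : MvPolynomial (Fin p) ℝ) :
    polyDeriv 𝕜 b' Q g x = c * polyDeriv ℂ b Q f (φ x) := by
  unfold polyDeriv
  rw [Finset.mul_sum]
  refine Finset.sum_congr rfl fun e _ => ?_
  have := opMonomial_rel
    (fun (g : E' → ℂ) (f : E → ℂ) => AnalyticAt ℂ f (φ x) ∧ g =ᶠ[𝓝 x] fun y => c * f (φ y))
    (fun j g f h => ⟨h.1.dirDeriv (b j), dirDeriv_comp hφ (hb j) h.1 h.2⟩) e ⟨hf, hg⟩
  rw [this.2.eq_of_nhds]
  ring

theorem polyDeriv_congr {p : ℕ} {b : Fin p → E} {f g : E → ℂ} {x : E} (hf : AnalyticAt ℂ f x)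
    (hg : g =ᶠ[𝓝 x] f) (Q : MvPolynomial (Fin p) ℝ) :
    polyDeriv ℂ b Q g x = polyDeriv ℂ b Q f x := by
  simpa using polyDeriv_comp (𝕜 := ℂ) (φ := id) (b' := b) (b := b) (c := 1) continuous_id
    (by simp) hf (by simpa using hg) Q

end DirectionalDerivatives

/-! ### Weights of subexponential growth on the positive orthant. -/

section SubExponential

variable {p : ℕ}

/-- Functions on the positive orthant that grow slower than every exponential. -/
structure SubExp (w : (Fin p → ℝ) → ℂ) : Prop where
  measurable : Measurable w
  bound : ∀ δ : ℝ, 0 < δ → ∃ C : ℝ, ∀ α : Fin p → ℝ, (∀ j, 0 < α j) →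
    ‖w α‖ ≤ C * Real.exp (δ * ∑ j, α j)

namespace SubExp

theorem const (z : ℂ) : SubExp (fun _ : Fin p → ℝ => z) where
  measurable := measurable_const
  bound _ hδ := ⟨‖z‖, fun _ hα => le_mul_of_one_le_right (norm_nonneg _) <|
    Real.one_le_exp (mul_nonneg hδ.le (Finset.sum_nonneg fun j _ => (hα j).le))⟩

theorem coord (j : Fin p) : SubExp (fun α : Fin p → ℝ => (α j : ℂ)) where
  measurable := by fun_prop
  bound δ hδ := ⟨δ⁻¹, fun α hα => by
    rw [Complex.norm_real, Real.norm_of_nonneg (hα j).le]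
    have h1 : α j ≤ ∑ i, α i :=
      Finset.single_le_sum (f := α) (fun i _ => (hα i).le) (Finset.mem_univ j)
    have h2 := Real.add_one_le_exp (δ * ∑ i, α i)
    rw [inv_mul_eq_div, le_div_iff₀ hδ]
    nlinarith⟩

theorem mul {w₁ w₂ : (Fin p → ℝ) → ℂ} (h₁ : SubExp w₁) (h₂ : SubExp w₂) :
    SubExp (fun α => w₁ α * w₂ α) where
  measurable := h₁.measurable.mul h₂.measurable
  bound δ hδ := by
    obtain ⟨C₁, hC₁⟩ := h₁.bound (δ / 2) (by positivity)
    obtain ⟨C₂, hC₂⟩ := h₂.bound (δ / 2) (by positivity)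
    refine ⟨C₁ * C₂, fun α hα => ?_⟩
    calc ‖w₁ α * w₂ α‖ = ‖w₁ α‖ * ‖w₂ α‖ := norm_mul _ _
      _ ≤ (C₁ * Real.exp (δ / 2 * ∑ j, α j)) * (C₂ * Real.exp (δ / 2 * ∑ j, α j)) :=
        mul_le_mul (hC₁ α hα) (hC₂ α hα) (norm_nonneg _) ((norm_nonneg _).trans (hC₁ α hα))
      _ = C₁ * C₂ * Real.exp (δ * ∑ j, α j) := by
        rw [mul_mul_mul_comm, ← Real.exp_add]
        ring_nf

theorem add {w₁ w₂ : (Fin p → ℝ) → ℂ} (h₁ : SubExp w₁) (h₂ : SubExp w₂) :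
    SubExp (fun α => w₁ α + w₂ α) where
  measurable := h₁.measurable.add h₂.measurable
  bound δ hδ := by
    obtain ⟨C₁, hC₁⟩ := h₁.bound δ hδ
    obtain ⟨C₂, hC₂⟩ := h₂.bound δ hδ
    refine ⟨C₁ + C₂, fun α hα => (norm_add_le _ _).trans ?_⟩
    rw [add_mul]
    exact add_le_add (hC₁ α hα) (hC₂ α hα)

theorem prod {ι : Type*} (t : Finset ι) {w : ι → (Fin p → ℝ) → ℂ} (h : ∀ i, SubExp (w i)) :
    SubExp (fun α => ∏ i ∈ t, w i α) := by
  classical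
  induction t using Finset.induction_on with
  | empty => simpa using const 1
  | insert i t hi ih =>
    simp only [Finset.prod_insert hi]
    exact (h i).mul ih

theorem polynomial (Q : MvPolynomial (Fin p) ℝ) :
    SubExp (fun α => (MvPolynomial.eval α Q : ℂ)) := by
  induction Q using MvPolynomial.induction_on with
  | C a => simpa using const (a : ℂ)
  | add P Q hP hQ => simpa using hP.add hQ
  | mul_X P j hP => simpa using hP.mul (coord j)

theorem cpow {u : (Fin p → ℝ) → ℝ} (hu : ∀ α : Fin p → ℝ, (∀ j, 0 < α j) → 0 < u α)
    (h : SubExp fun α => (u α : ℂ)) {z : ℂ} (hz : 0 ≤ z.re) :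
    SubExp (fun α => (u α : ℂ) ^ z) where
  measurable := h.measurable.pow_const z
  bound δ hδ := by
    have hr : 0 < z.re + 1 := by linarith
    -- Raising to the power `z.re` gives the rate `δ * z.re / (z.re + 1) ≤ δ`; the `+ 1` covers
    -- `z.re = 0`.
    obtain ⟨C, hC⟩ := h.bound (δ / (z.re + 1)) (by positivity)
    refine ⟨|C| ^ z.re, fun α hα => ?_⟩
    have hS : 0 ≤ ∑ j, α j := Finset.sum_nonneg fun j _ => (hα j).le
    have h1 : u α ≤ |C| * Real.exp (δ / (z.re + 1) * ∑ j, α j) := by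
      have := hC α hα
      rw [Complex.norm_real, Real.norm_of_nonneg (hu α hα).le] at this
      exact this.trans (mul_le_mul_of_nonneg_right (le_abs_self C) (Real.exp_pos _).le)
    rw [Complex.norm_cpow_eq_rpow_re_of_pos (hu α hα)]
    refine (Real.rpow_le_rpow (hu α hα).le h1 hz).trans ?_
    rw [Real.mul_rpow (abs_nonneg C) (Real.exp_pos _).le, ← Real.exp_mul]
    refine mul_le_mul_of_nonneg_left (Real.exp_le_exp.2 ?_) (by positivity)
    have : δ / (z.re + 1) * (∑ j, α j) * z.re = δ * (∑ j, α j) * (z.re / (z.re + 1)) := by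
      field_simp
    rw [this]
    exact mul_le_of_le_one_right (by positivity) ((div_le_one hr).2 (by linarith))

end SubExp

theorem measurableSet_orthant : MeasurableSet {α : Fin p → ℝ | ∀ j, 0 < α j} := by
  rw [Set.ofPred_forall]
  exact MeasurableSet.iInter fun j => measurableSet_lt measurable_const (measurable_pi_apply j)

theorem integrableOn_exp_neg_sum {c : ℝ} (hc : 0 < c) :
    IntegrableOn (fun α : Fin p → ℝ => Real.exp (-c * ∑ j, α j)) {α | ∀ j, 0 < α j} := by
  have h1 : Integrable (fun x : ℝ => (Set.Ioi (0 : ℝ)).indicator (fun x => Real.exp (-c * x)) x) :=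
    (integrable_indicator_iff measurableSet_Ioi).2 (exp_neg_integrableOn_Ioi 0 hc)
  have h2 := Integrable.fintype_prod (ι := Fin p) (f := fun _ => fun x : ℝ =>
    (Set.Ioi (0 : ℝ)).indicator (fun x => Real.exp (-c * x)) x) (μ := fun _ => volume)
    fun _ => h1
  refine (h2.integrableOn (s := {α : Fin p → ℝ | ∀ j, 0 < α j})).congr_fun ?_
    measurableSet_orthant
  intro α hα
  have : ∀ j, α j ∈ Set.Ioi (0 : ℝ) := hα
  simp only [Set.indicator_of_mem (this _)]
  rw [← Real.exp_sum, Finset.mul_sum]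

end SubExponential

/-! ### The polynomial `𝒰` and differentiation under the integral sign. -/

namespace Family

variable {p L n : ℕ} (Γ : Family p L n)

theorem aeval_symanzikU {R : Type*} [CommRing R] [Algebra ℝ R] (z : Fin p → R) :
    MvPolynomial.aeval z Γ.symanzikU = Matrix.det (.of fun a b : Fin L =>
      ∑ j, algebraMap ℝ R ((Γ.loop j a : ℝ) * (Γ.loop j b : ℝ)) * z j) := by
  unfold symanzikU
  rw [AlgHom.map_det]
  congr 1
  ext a b
  simp [loopMatrix]

/-- Homogeneity of degree `L`: `𝒰` is the determinant of an `L × L` matrix linear in `α`. -/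
theorem aeval_mul_symanzikU (c : ℂ) (α : Fin p → ℝ) :
    MvPolynomial.aeval (fun j => c * (α j : ℂ)) Γ.symanzikU =
      c ^ L * (MvPolynomial.eval α Γ.symanzikU : ℂ) := by
  have h : (MvPolynomial.eval α Γ.symanzikU : ℂ) =
      MvPolynomial.aeval (fun j => (α j : ℂ)) Γ.symanzikU := by
    have := MvPolynomial.aeval_algebraMap_apply (A := ℝ) ℂ α Γ.symanzikU
    simpa [MvPolynomial.aeval_eq_eval, Function.comp_def] using this.symm
  rw [h, aeval_symanzikU, aeval_symanzikU]
  have := Matrix.det_smul (.of fun a b : Fin L =>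
      ∑ j, algebraMap ℝ ℂ ((Γ.loop j a : ℝ) * (Γ.loop j b : ℝ)) * (α j : ℂ)) c
  rw [Fintype.card_fin] at this
  rw [← this]
  congr 1
  ext a b
  simp only [Matrix.smul_apply, Matrix.of_apply, smul_eq_mul, Finset.mul_sum]
  exact Finset.sum_congr rfl fun j _ => by ring

/-- `A(α) = Mᵀ diag(α) M`, where `M` is injective by independence of the loop momenta, so `A(α)` is
positive definite. -/
theorem symanzikU_pos {α : Fin p → ℝ} (hα : ∀ j, 0 < α j) :
    0 < MvPolynomial.eval α Γ.symanzikU := by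
  have h := Γ.aeval_symanzikU α
  rw [MvPolynomial.aeval_eq_eval] at h
  change MvPolynomial.eval α Γ.symanzikU = _ at h
  rw [h]
  set M : Matrix (Fin p) (Fin L) ℝ := fun j a => (Γ.loop j a : ℝ)
  have hM : Function.Injective M.mulVec := by
    rw [Matrix.mulVec_injective_iff]
    exact Γ.loop_indep
  have hpos := (Matrix.PosDef.diagonal hα).conjTranspose_mul_mul_same hM
  have heq : (Matrix.of fun a b : Fin L =>
      ∑ j, algebraMap ℝ ℝ ((Γ.loop j a : ℝ) * (Γ.loop j b : ℝ)) * α j) =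
      M.conjTranspose * Matrix.diagonal α * M := by
    ext a b
    rw [Matrix.mul_apply, Matrix.of_apply]
    refine Finset.sum_congr rfl fun j _ => ?_
    rw [Matrix.mul_diagonal, Matrix.conjTranspose_apply, star_trivial, Algebra.algebraMap_self,
      RingHom.id_apply]
    ring
  rw [heq]
  exact hpos.det_pos

theorem fullF_div_add (s : Matrix (Fin n) (Fin n) ℝ) (m z : Fin p → ℂ) {α : Fin p → ℝ}
    (hα : ∀ j, 0 < α j) :
    Γ.fullF s (m + z) α / (MvPolynomial.eval α Γ.symanzikU : ℂ) =
      Γ.fullF s m α / (MvPolynomial.eval α Γ.symanzikU : ℂ) + ∑ j, z j * (α j : ℂ) := by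
  have hU : (MvPolynomial.eval α Γ.symanzikU : ℂ) ≠ 0 :=
    Complex.ofReal_ne_zero.2 (Γ.symanzikU_pos hα).ne'
  unfold fullF
  simp only [Pi.add_apply, add_mul, Finset.sum_add_distrib]
  field_simp
  ring

/-- The exponent `e^{iθ} ℱ / 𝒰` of the Schwinger integral. -/
def expo (s : Matrix (Fin n) (Fin n) ℝ) (θ : ℝ) (m : Fin p → ℂ) (α : Fin p → ℝ) : ℂ :=
  Complex.exp (Complex.I * θ) * (Γ.fullF s m α / (MvPolynomial.eval α Γ.symanzikU : ℂ))

variable {s : Matrix (Fin n) (Fin n) ℝ} {θ : ℝ} {m : Fin p → ℂ}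

theorem measurable_expo : Measurable (Γ.expo s θ m) := by
  have h : ∀ Q : MvPolynomial (Fin p) ℝ, Measurable fun α : Fin p → ℝ => (MvPolynomial.eval α Q : ℂ) :=
    fun Q => (SubExp.polynomial Q).measurable
  have h1 := h Γ.symanzikU
  have h2 := h (Γ.symanzikF s)
  unfold expo fullF
  fun_prop

theorem expo_add (z : Fin p → ℂ) {α : Fin p → ℝ} (hα : ∀ j, 0 < α j) :
    Γ.expo s θ (m + z) α =
      Γ.expo s θ m α + Complex.exp (Complex.I * θ) * ∑ j, z j * (α j : ℂ) := by
  unfold expo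
  rw [Γ.fullF_div_add s m z hα, mul_add]

theorem norm_exp_I_mul_ofReal (θ : ℝ) : ‖Complex.exp (Complex.I * θ)‖ = 1 := by
  rw [mul_comm, Complex.norm_exp_ofReal_mul_I]

/-- Moving the masses by at most `r` costs at most `r` in the decay rate. This yields openness of
`decayMasses` and a domination uniform in nearby masses. -/
theorem le_re_expo_add {c r : ℝ} {α : Fin p → ℝ} (hα : ∀ j, 0 < α j)
    (h : c * ∑ j, α j ≤ (Γ.expo s θ m α).re) {z : Fin p → ℂ} (hz : ‖z‖ ≤ r) :
    (c - r) * ∑ j, α j ≤ (Γ.expo s θ (m + z) α).re := by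
  rw [Γ.expo_add z hα, Complex.add_re]
  have h1 : ‖Complex.exp (Complex.I * θ) * ∑ j, z j * (α j : ℂ)‖ ≤ r * ∑ j, α j := by
    rw [norm_mul, norm_exp_I_mul_ofReal, one_mul, Finset.mul_sum]
    refine (norm_sum_le _ _).trans (Finset.sum_le_sum fun j _ => ?_)
    rw [norm_mul, Complex.norm_real, Real.norm_of_nonneg (hα j).le]
    exact mul_le_mul_of_nonneg_right ((norm_le_pi_norm z j).trans hz) (hα j).le
  have h2 := (abs_le.1 (Complex.abs_re_le_norm
    (Complex.exp (Complex.I * θ) * ∑ j, z j * (α j : ℂ)))).1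
  linarith

theorem isOpen_decayMasses : IsOpen (Γ.decayMasses s θ) := by
  rw [Metric.isOpen_iff]
  rintro m ⟨c, hc, h⟩
  refine ⟨c / 2, by positivity, fun m' hm' => ⟨c / 2, by positivity, fun α hα => ?_⟩⟩
  have := Γ.le_re_expo_add (z := m' - m) (r := c / 2) hα (h α hα)
    (by rw [← dist_eq_norm]; exact (Metric.mem_ball.1 hm').le)
  rw [add_sub_cancel] at this
  unfold expo at this
  linarith

theorem norm_mul_exp_neg_le {w : (Fin p → ℝ) → ℂ} {C δ c : ℝ} {α : Fin p → ℝ}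
    (hw : ‖w α‖ ≤ C * Real.exp (δ * ∑ j, α j)) (h : c * ∑ j, α j ≤ (Γ.expo s θ m α).re) :
    ‖w α * Complex.exp (-Γ.expo s θ m α)‖ ≤ C * Real.exp (-(c - δ) * ∑ j, α j) := by
  rw [norm_mul, Complex.norm_exp, Complex.neg_re]
  calc ‖w α‖ * Real.exp (-(Γ.expo s θ m α).re)
      ≤ (C * Real.exp (δ * ∑ j, α j)) * Real.exp (-(c * ∑ j, α j)) :=
        mul_le_mul hw (Real.exp_le_exp.2 (neg_le_neg h)) (Real.exp_pos _).le
          ((norm_nonneg _).trans hw)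
    _ = C * Real.exp (-(c - δ) * ∑ j, α j) := by
        rw [mul_assoc, ← Real.exp_add]
        ring_nf

/-- The Laplace type integral with the exponent of the Schwinger integral and a general weight. -/
def weightInt (s : Matrix (Fin n) (Fin n) ℝ) (θ : ℝ) (w : (Fin p → ℝ) → ℂ) (m : Fin p → ℂ) : ℂ :=
  ∫ α in {α : Fin p → ℝ | ∀ j, 0 < α j}, w α * Complex.exp (-Γ.expo s θ m α)

theorem measurable_weight {w : (Fin p → ℝ) → ℂ} (hw : SubExp w) :
    Measurable fun α => w α * Complex.exp (-Γ.expo s θ m α) :=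
  hw.measurable.mul (Γ.measurable_expo.neg.cexp)

theorem integrable_weight {w : (Fin p → ℝ) → ℂ} (hw : SubExp w) (hm : m ∈ Γ.decayMasses s θ) :
    IntegrableOn (fun α => w α * Complex.exp (-Γ.expo s θ m α))
      {α : Fin p → ℝ | ∀ j, 0 < α j} := by
  obtain ⟨c, hc, h⟩ := hm
  obtain ⟨C, hC⟩ := hw.bound (c / 2) (by positivity)
  refine Integrable.mono' ((integrableOn_exp_neg_sum (c := c - c / 2) (by linarith)).const_mul C)
    (Γ.measurable_weight hw).aestronglyMeasurable ?_
  filter_upwards [ae_restrict_mem measurableSet_orthant] with α hα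
  exact Γ.norm_mul_exp_neg_le (hC α hα) (h α hα)

theorem dirDeriv_weightInt {w : (Fin p → ℝ) → ℂ} (hw : SubExp w) (hm : m ∈ Γ.decayMasses s θ)
    (j : Fin p) :
    dirDeriv ℂ (Pi.single j 1) (Γ.weightInt s θ w) m =
      Γ.weightInt s θ (fun α => -Complex.exp (Complex.I * θ) * (α j : ℂ) * w α) m := by
  have hint := Γ.integrable_weight hw hm
  obtain ⟨c, hc, h⟩ := hm
  have hw' : SubExp (fun α : Fin p → ℝ => -Complex.exp (Complex.I * θ) * (α j : ℂ) * w α) :=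
    ((SubExp.const _).mul (SubExp.coord j)).mul hw
  -- Of the rate `c`, the weight uses `c / 4` and the ball of masses of radius `c / 2` uses `c / 2`;
  -- the rate `c / 4` remains for an integrable bound.
  obtain ⟨C, hC⟩ := hw'.bound (c / 4) (by positivity)
  set F : ℂ → (Fin p → ℝ) → ℂ :=
    fun t α => w α * Complex.exp (-Γ.expo s θ (m + t • Pi.single j 1) α) with hF
  set F' : ℂ → (Fin p → ℝ) → ℂ := fun t α => (-Complex.exp (Complex.I * θ) * (α j : ℂ) * w α) *
    Complex.exp (-Γ.expo s θ (m + t • Pi.single j 1) α) with hF'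
  have hzero : m + (0 : ℂ) • Pi.single j 1 = m := by rw [zero_smul, add_zero]
  have hF_int : Integrable (F 0) (volume.restrict {α : Fin p → ℝ | ∀ j, 0 < α j}) := by
    simp only [hF, hzero]
    exact hint
  have hbound : ∀ᵐ α ∂volume.restrict {α : Fin p → ℝ | ∀ j, 0 < α j},
      ∀ t ∈ Metric.ball (0 : ℂ) (c / 2),
        ‖F' t α‖ ≤ C * Real.exp (-(c - c / 2 - c / 4) * ∑ j, α j) := by
    filter_upwards [ae_restrict_mem measurableSet_orthant] with α hα t ht
    have hz : ‖t • (Pi.single j 1 : Fin p → ℂ)‖ ≤ c / 2 := by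
      rw [norm_smul, Pi.norm_single, norm_one, mul_one]
      exact (mem_ball_zero_iff.1 ht).le
    exact Γ.norm_mul_exp_neg_le (w := fun α : Fin p → ℝ =>
      -Complex.exp (Complex.I * θ) * (α j : ℂ) * w α) (hC α hα) (Γ.le_re_expo_add hα (h α hα) hz)
  have hdiff : ∀ᵐ α ∂volume.restrict {α : Fin p → ℝ | ∀ j, 0 < α j},
      ∀ t ∈ Metric.ball (0 : ℂ) (c / 2), HasDerivAt (fun t => F t α) (F' t α) t := by
    filter_upwards [ae_restrict_mem measurableSet_orthant] with α hα t _
    have h1 : ∀ t : ℂ, Γ.expo s θ (m + t • Pi.single j 1) α =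
        Γ.expo s θ m α + Complex.exp (Complex.I * θ) * (t * (α j : ℂ)) := by
      intro t
      rw [Γ.expo_add _ hα, Finset.sum_eq_single j] <;> simp +contextual
    have h2 : HasDerivAt (fun t : ℂ => -(Γ.expo s θ m α +
        Complex.exp (Complex.I * θ) * (t * (α j : ℂ))))
        (-(Complex.exp (Complex.I * θ) * (1 * (α j : ℂ)))) t :=
      ((((hasDerivAt_id t).mul_const _).const_mul _).const_add _).neg
    simp only [hF, hF', h1]
    exact (h2.cexp.const_mul (w α)).congr_deriv (by ring)
  have hb_int : Integrable (fun α : Fin p → ℝ => C * Real.exp (-(c - c / 2 - c / 4) * ∑ j, α j))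
      (volume.restrict {α : Fin p → ℝ | ∀ j, 0 < α j}) :=
    (integrableOn_exp_neg_sum (c := c - c / 2 - c / 4) (by linarith)).const_mul C
  have key := hasDerivAt_integral_of_dominated_loc_of_deriv_le
    (Metric.ball_mem_nhds (0 : ℂ) (by positivity : 0 < c / 2))
    (Eventually.of_forall fun t => (Γ.measurable_weight hw).aestronglyMeasurable)
    (F := F) hF_int (F' := F') (Γ.measurable_weight hw').aestronglyMeasurable hbound hb_int hdiff
  have h3 := key.2.deriv
  simp only [hF', hzero] at h3
  exact h3

theorem polyDeriv_weightInt {w : (Fin p → ℝ) → ℂ} (hw : SubExp w) (hm : m ∈ Γ.decayMasses s θ)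
    (Q : MvPolynomial (Fin p) ℝ) :
    polyDeriv ℂ (fun j => Pi.single j 1) Q (Γ.weightInt s θ w) m =
      Γ.weightInt s θ (fun α => MvPolynomial.aeval
        (fun j => -Complex.exp (Complex.I * θ) * (α j : ℂ)) Q * w α) m := by
  have mono : ∀ e : Fin p →₀ ℕ, SubExp (fun α : Fin p → ℝ =>
        (∏ j, (-Complex.exp (Complex.I * θ) * (α j : ℂ)) ^ e j) * w α) ∧
      opMonomial (fun j : Fin p => dirDeriv ℂ (Pi.single j 1)) e (Γ.weightInt s θ w) m =
        Γ.weightInt s θ (fun α =>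
          (∏ j, (-Complex.exp (Complex.I * θ) * (α j : ℂ)) ^ e j) * w α) m := by
    intro e
    -- The relation demands equality on all of the open set `decayMasses`, so that it survives a
    -- further derivative.
    have := opMonomial_rel (T := fun j : Fin p => dirDeriv ℂ (Pi.single j 1))
      (S := fun (j : Fin p) (w : (Fin p → ℝ) → ℂ) α =>
        (-Complex.exp (Complex.I * θ) * (α j : ℂ)) * w α)
      (fun (g : (Fin p → ℂ) → ℂ) (w : (Fin p → ℝ) → ℂ) => SubExp w ∧
        ∀ m ∈ Γ.decayMasses s θ, g m = Γ.weightInt s θ w m)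
      (fun j g w h => ⟨((SubExp.const _).mul (SubExp.coord j)).mul h.1, fun m hm => by
        have hg : g =ᶠ[𝓝 m] Γ.weightInt s θ w := by
          filter_upwards [Γ.isOpen_decayMasses.mem_nhds hm] with m' hm' using h.2 m' hm'
        rw [← Γ.dirDeriv_weightInt h.1 hm j]
        exact hg.lineDeriv_eq⟩) e
      (f := Γ.weightInt s θ w) (g := w) ⟨hw, fun _ _ => rfl⟩
    rw [opMonomial_mul (fun (j : Fin p) (α : Fin p → ℝ) =>
      -Complex.exp (Complex.I * θ) * (α j : ℂ))] at this
    exact ⟨this.1, this.2 m hm⟩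
  unfold polyDeriv
  simp only [(mono _).2]
  unfold weightInt
  simp only [← integral_const_mul]
  rw [← integral_finsetSum _ fun e _ => (Γ.integrable_weight (mono e).1 hm).const_mul _]
  refine integral_congr_ae (Eventually.of_forall fun α => ?_)
  simp only [MvPolynomial.aeval_def, MvPolynomial.eval₂_eq', Finset.sum_mul]
  refine Finset.sum_congr rfl fun e _ => ?_
  simp only [mul_assoc, Complex.coe_algebraMap]

end Family

/-! ### Dimensional shift of the Schwinger integral and of its continuations. -/

namespace Family

variable {p L n : ℕ} (Γ : Family p L n) {s : Matrix (Fin n) (Fin n) ℝ} {θ : ℝ} {m : Fin p → ℂ}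

/-- The weight of the Schwinger integral, `∏ j α_j^{ν_j - 1} / Γ(ν_j) 𝒰(α)^{-D/2}`. -/
def schwingerWeight (ν : Fin p → ℂ) (D : ℂ) (α : Fin p → ℝ) : ℂ :=
  (∏ j, (α j : ℂ) ^ (ν j - 1) / Complex.Gamma (ν j)) *
    (MvPolynomial.eval α Γ.symanzikU : ℂ) ^ (-D / 2)

/-- Under these bounds all powers have exponents of nonnegative real part, so the weight is not
singular at the boundary of the orthant. -/
theorem subExp_schwingerWeight {ν : Fin p → ℂ} {D : ℂ} (hν : ∀ j, 1 ≤ (ν j).re)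
    (hD : D.re ≤ 0) : SubExp (Γ.schwingerWeight ν D) := by
  refine (SubExp.prod _ fun j => ?_).mul
    (SubExp.cpow (fun α hα => Γ.symanzikU_pos hα) (SubExp.polynomial _) ?_)
  · simp only [div_eq_mul_inv]
    refine SubExp.mul (SubExp.cpow (u := fun α : Fin p → ℝ => α j) (fun α hα => hα j)
      (SubExp.coord j) ?_) (SubExp.const _)
    simpa using hν j
  · have : (-D / 2).re = -D.re / 2 := by
      rw [show (2 : ℂ) = ((2 : ℝ) : ℂ) by norm_num, Complex.div_ofReal_re, Complex.neg_re]
    rw [this]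
    linarith

theorem const_mul_schwinger (c : ℂ) (ν : Fin p → ℂ) (D : ℂ) (m : Fin p → ℂ) :
    c * Γ.schwinger s θ m ν D = Γ.weightInt s θ (fun α =>
      c * Complex.exp (Complex.I * θ * (∑ j, ν j - L * D / 2)) * Γ.schwingerWeight ν D α) m := by
  unfold weightInt schwinger
  rw [← mul_assoc, ← integral_const_mul]
  refine integral_congr_ae (Eventually.of_forall fun α => ?_)
  simp only [schwingerWeight, expo]
  ring

theorem polyDeriv_schwinger {ν : Fin p → ℂ} {D : ℂ} (hν : ∀ j, 1 ≤ (ν j).re)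
    (hD : (D + 2).re ≤ 0) (hm : m ∈ Γ.decayMasses s θ) (c : ℂ) :
    polyDeriv ℂ (fun j => Pi.single j 1) Γ.symanzikU
        (fun m => c * Γ.schwinger s θ m ν (D + 2)) m =
      (-1) ^ L * (c * Γ.schwinger s θ m ν D) := by
  have hw : SubExp (fun α : Fin p → ℝ =>
      c * Complex.exp (Complex.I * θ * (∑ j, ν j - L * (D + 2) / 2)) *
        Γ.schwingerWeight ν (D + 2) α) :=
    (SubExp.const _).mul (Γ.subExp_schwingerWeight hν hD)
  simp only [Γ.const_mul_schwinger c ν (D + 2)]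
  rw [Γ.polyDeriv_weightInt hw hm, ← mul_assoc, Γ.const_mul_schwinger]
  unfold weightInt
  refine setIntegral_congr_fun measurableSet_orthant fun α hα => ?_
  have hU : (MvPolynomial.eval α Γ.symanzikU : ℂ) ≠ 0 :=
    Complex.ofReal_ne_zero.2 (Γ.symanzikU_pos hα).ne'
  have h1 : (MvPolynomial.eval α Γ.symanzikU : ℂ) *
      (MvPolynomial.eval α Γ.symanzikU : ℂ) ^ (-(D + 2) / 2) =
      (MvPolynomial.eval α Γ.symanzikU : ℂ) ^ (-D / 2) := by
    rw [show -D / 2 = 1 + -(D + 2) / 2 by ring, Complex.cpow_add _ _ hU, Complex.cpow_one]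
  have h2 : Complex.exp (Complex.I * θ) ^ L *
      Complex.exp (Complex.I * θ * (∑ j, ν j - L * (D + 2) / 2)) =
      Complex.exp (Complex.I * θ * (∑ j, ν j - L * D / 2)) := by
    rw [← Complex.exp_nat_mul, ← Complex.exp_add]
    congr 1
    ring
  simp only [Γ.aeval_mul_symanzikU, schwingerWeight]
  rw [← h1, ← h2, neg_pow]
  ring

/-- The continuation of the Schwinger integral in two dimensions less. -/
def Continuation.lower {Γ : Family p L n} (C : Γ.Continuation s) : Γ.Continuation s where
  lo := C.lo
  hi := C.hi - 2
  num := fun x => (-1) ^ L * polyDeriv ℂ (fun j => (Pi.single j 1, 0, 0)) Γ.symanzikU C.num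
    (x.1, x.2.1, x.2.2 + 2)
  den := fun w => C.den (w.1, w.2 + 2)
  num_analytic := by
    rintro ⟨m, ν, D⟩ ⟨hm, hν, hD⟩
    have h := C.num_analytic (m, ν, D + 2) ⟨hm, hν, by
      simp only [Complex.add_re, Complex.re_ofNat] at hD ⊢; linarith⟩
    refine analyticAt_const.mul ?_
    exact AnalyticAt.fun_comp (h.polyDeriv _ _) (f := fun x : (Fin p → ℂ) × (Fin p → ℂ) × ℂ =>
      (x.1, x.2.1, x.2.2 + 2)) (x := (m, ν, D))
      (analyticAt_fst.prod ((analyticAt_fst.comp analyticAt_snd).prod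
        ((analyticAt_snd.comp analyticAt_snd).add analyticAt_const)))
  den_analytic := by
    rintro ⟨ν, D⟩ ⟨hν, hD⟩
    have h := C.den_analytic (ν, D + 2) ⟨hν, by
      simp only [Complex.add_re, Complex.re_ofNat] at hD ⊢; linarith⟩
    exact AnalyticAt.fun_comp h (f := fun x : (Fin p → ℂ) × ℂ => (x.1, x.2 + 2)) (x := (ν, D))
      (analyticAt_fst.prod (analyticAt_snd.add analyticAt_const))
  agree := by
    obtain ⟨B, hB, h⟩ := C.agree
    -- `D.re < -(B + 2)` puts `D + 2` in the range of `C.agree`; with `0 ≤ B` it also gives the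
    -- bounds on `ν` and `D + 2` in `polyDeriv_schwinger`.
    refine ⟨B + 2, by linarith, fun θ hθ m hm ν D hν hD₁ hD₂ => ?_⟩
    have hre : (D + 2).re = D.re + 2 := by simp
    have hmem : (m, ν, D + 2) ∈
        Γ.schwingerMasses s ×ˢ {w : (Fin p → ℂ) × ℂ | (∀ j, C.lo j < (w.1 j).re) ∧ w.2.re < C.hi} :=
      ⟨⟨θ, hθ, hm⟩, fun j => (hν j).1, by simp only [hre]; linarith⟩
    have heq : (fun z => C.den (ν, D + 2) * Γ.schwinger s θ z ν (D + 2)) =ᶠ[𝓝 m]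
        fun z => 1 * C.num (z, ν, D + 2) := by
      filter_upwards [Γ.isOpen_decayMasses.mem_nhds hm] with z hz
      rw [one_mul, h θ hθ z hz ν (D + 2) (fun j => ⟨(hν j).1, by linarith [(hν j).2]⟩)
        (by linarith) (by linarith)]
    have key := polyDeriv_comp (𝕜 := ℂ) (φ := fun z : Fin p → ℂ => (z, ν, D + 2))
      (b' := fun j => Pi.single j 1) (b := fun j => (Pi.single j 1, 0, 0)) (by fun_prop)
      (by simp) (C.num_analytic _ hmem) heq Γ.symanzikU
    rw [Γ.polyDeriv_schwinger (fun j => by linarith [(hν j).2]) (by linarith) hm, one_mul] at key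
    rw [← key, ← mul_assoc, ← mul_pow]
    simp

theorem Continuation.RegularAt.lower {Γ : Family p L n} {C : Γ.Continuation s} {ν : Fin p → ℂ}
    {D : ℂ} (h : C.RegularAt ν D) : C.lower.RegularAt ν (D - 2) := by
  refine ⟨h.1, ?_, ?_⟩
  · simpa [Continuation.lower] using h.2.1
  · simpa [Continuation.lower] using h.2.2

/-- Both sides are analytic on the convex intersection of the two regions and equal `den₁ * den₂`
times the Schwinger integral far inside it, so the identity theorem applies. Cross-multiplication
avoids the zeros of the denominators. -/
theorem Continuation.num_mul_den {Γ : Family p L n} (C₁ C₂ : Γ.Continuation s)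
    (hm : m ∈ Γ.schwingerMasses s) {ν : Fin p → ℂ} {D : ℂ} (hν₁ : ∀ j, C₁.lo j < (ν j).re)
    (hν₂ : ∀ j, C₂.lo j < (ν j).re) (hD₁ : D.re < C₁.hi) (hD₂ : D.re < C₂.hi) :
    C₁.num (m, ν, D) * C₂.den (ν, D) = C₂.num (m, ν, D) * C₁.den (ν, D) := by
  obtain ⟨θ, hθ, hmθ⟩ := hm
  obtain ⟨B₁, -, h₁⟩ := C₁.agree
  obtain ⟨B₂, -, h₂⟩ := C₂.agree
  have hreg : ∀ (lo : Fin p → ℝ) (hi : ℝ), Convex ℝ {w : (Fin p → ℂ) × ℂ |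
      (∀ j, lo j < (w.1 j).re) ∧ w.2.re < hi} ∧ IsOpen {w : (Fin p → ℂ) × ℂ |
      (∀ j, lo j < (w.1 j).re) ∧ w.2.re < hi} := by
    intro lo hi
    constructor
    · rintro ⟨ν, D⟩ ⟨hν, hD⟩ ⟨ν', D'⟩ ⟨hν', hD'⟩ a b ha hb hab
      constructor
      · intro j
        have := convex_Ioi (lo j) (hν j) (hν' j) ha hb hab
        simpa using this
      · have := convex_Iio hi hD hD' ha hb hab
        simpa using this
    · rw [Set.ofPred_and, Set.ofPred_forall]
      refine IsOpen.inter (isOpen_iInter_of_finite fun j => ?_) ?_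
      · exact isOpen_lt continuous_const (by fun_prop)
      · exact isOpen_lt (by fun_prop) continuous_const
  set W := {w : (Fin p → ℂ) × ℂ | (∀ j, C₁.lo j < (w.1 j).re) ∧ w.2.re < C₁.hi} ∩
    {w : (Fin p → ℂ) × ℂ | (∀ j, C₂.lo j < (w.1 j).re) ∧ w.2.re < C₂.hi}
  have hconn : IsPreconnected W := ((hreg _ _).1.inter (hreg _ _).1).isPreconnected
  have hnum : ∀ C : Γ.Continuation s, AnalyticOnNhd ℂ (fun w => C.num (m, w))
      {w : (Fin p → ℂ) × ℂ | (∀ j, C.lo j < (w.1 j).re) ∧ w.2.re < C.hi} := fun C w hw =>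
    AnalyticAt.fun_comp (C.num_analytic (m, w) ⟨⟨θ, hθ, hmθ⟩, hw⟩)
      (f := fun w : (Fin p → ℂ) × ℂ => (m, w)) (by fun_prop)
  have hana₁ : AnalyticOnNhd ℂ (fun w => C₁.num (m, w) * C₂.den w) W := fun w hw =>
    (hnum C₁ w hw.1).mul (C₂.den_analytic w hw.2)
  have hana₂ : AnalyticOnNhd ℂ (fun w => C₂.num (m, w) * C₁.den w) W := fun w hw =>
    (hnum C₂ w hw.2).mul (C₁.den_analytic w hw.1)
  -- Bounds beyond which both continuations agree with the integral.
  let lo : Fin p → ℝ := fun j => max (max (C₁.lo j) (C₂.lo j)) (max B₁ B₂)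
  let hi : ℝ := min (min C₁.hi C₂.hi) (min (-B₁) (-B₂))
  let w₀ : (Fin p → ℂ) × ℂ := (fun j => ((lo j + 1 : ℝ) : ℂ), ((hi - 1 : ℝ) : ℂ))
  have hw₀ : w₀ ∈ {w : (Fin p → ℂ) × ℂ | (∀ j, lo j < (w.1 j).re) ∧ w.2.re < hi} := by
    constructor
    · intro j
      rw [Complex.ofReal_re]
      linarith
    · rw [Complex.ofReal_re]
      linarith
  have hsub : ∀ w ∈ {w : (Fin p → ℂ) × ℂ | (∀ j, lo j < (w.1 j).re) ∧ w.2.re < hi},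
      w ∈ W ∧ (∀ j, B₁ < (w.1 j).re ∧ B₂ < (w.1 j).re) ∧ w.2.re < -B₁ ∧ w.2.re < -B₂ := by
    rintro w ⟨hw₁, hw₂⟩
    simp only [lo, hi, max_lt_iff, lt_min_iff] at hw₁ hw₂
    exact ⟨⟨⟨fun j => (hw₁ j).1.1, hw₂.1.1⟩, fun j => (hw₁ j).1.2, hw₂.1.2⟩,
      fun j => (hw₁ j).2, hw₂.2.1, hw₂.2.2⟩
  have hev : (fun w => C₁.num (m, w) * C₂.den w) =ᶠ[𝓝 w₀] fun w => C₂.num (m, w) * C₁.den w := by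
    filter_upwards [(hreg lo hi).2.mem_nhds hw₀] with w hw
    obtain ⟨hW, hB, hD₁, hD₂⟩ := hsub w hw
    have e₁ := h₁ θ hθ m hmθ w.1 w.2 (fun j => ⟨hW.1.1 j, (hB j).1⟩) hW.1.2 hD₁
    have e₂ := h₂ θ hθ m hmθ w.1 w.2 (fun j => ⟨hW.2.1 j, (hB j).2⟩) hW.2.2 hD₂
    simp only [Prod.mk.eta] at e₁ e₂
    rw [e₁, e₂]
    ring
  exact hana₁.eqOn_of_preconnected_of_eventuallyEq hana₂ hconn (hsub w₀ hw₀).1 hev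
    (show (ν, D) ∈ W from ⟨⟨hν₁, hD₁⟩, hν₂, hD₂⟩)

/-! ### The continued integral at complex masses. -/

theorem continued_eq {ν : Fin p → ℂ} {D : ℂ} {C : Γ.Continuation s} (hC : C.RegularAt ν D)
    (hm : m ∈ Γ.schwingerMasses s) :
    Γ.continued s m ν D = C.num (m, ν, D) / C.den (ν, D) := by
  have h : Γ.IsRegular s ν D := ⟨C, hC⟩
  have h' := h.choose_spec
  unfold continued
  rw [dif_pos h, div_eq_div_iff h'.2.2 hC.2.2]
  exact h.choose.num_mul_den C hm h'.1 hC.1 h'.2.1 hC.2.1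

/-- As a function of the masses the integral is a constant times `C.num`, so mass derivatives act on
the numerator alone. -/
theorem integralC_eq {ν : Fin p → ℤ} {D₀ : ℤ} {ε : ℂ} {C : Γ.Continuation s}
    (hC : C.RegularAt (fun j => (ν j : ℂ)) (D₀ - 2 * ε)) (hm : m ∈ Γ.schwingerMasses s) :
    Γ.integralC s ν D₀ ε m = Complex.exp (Real.eulerMascheroniConstant * L * ε) /
      C.den (fun j => (ν j : ℂ), D₀ - 2 * ε) * C.num (m, fun j => (ν j : ℂ), D₀ - 2 * ε) := by
  unfold integralC
  rw [Γ.continued_eq hC hm]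
  ring

theorem isOpen_schwingerMasses : IsOpen (Γ.schwingerMasses s) := by
  have : Γ.schwingerMasses s = ⋃ θ ∈ Set.Icc (0 : ℝ) (Real.pi / 2), Γ.decayMasses s θ := by
    ext m
    simp [schwingerMasses]
  rw [this]
  exact isOpen_biUnion fun θ _ => Γ.isOpen_decayMasses

theorem analyticAt_integralC {ν : Fin p → ℤ} {D₀ : ℤ} {ε : ℂ}
    (hreg : Γ.IsRegular s (fun j => (ν j : ℂ)) (D₀ - 2 * ε)) (hm : m ∈ Γ.schwingerMasses s) :
    AnalyticAt ℂ (Γ.integralC s ν D₀ ε) m := by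
  obtain ⟨C, hC⟩ := hreg
  have h : AnalyticAt ℂ (fun z => Complex.exp (Real.eulerMascheroniConstant * L * ε) /
      C.den (fun j => (ν j : ℂ), D₀ - 2 * ε) * C.num (z, fun j => (ν j : ℂ), D₀ - 2 * ε)) m :=
    analyticAt_const.mul (AnalyticAt.fun_comp (C.num_analytic _ ⟨hm, hC.1, hC.2.1⟩)
      (f := fun z : Fin p → ℂ => (z, fun j => (ν j : ℂ), D₀ - 2 * ε)) (by fun_prop))
  refine h.congr ?_
  filter_upwards [Γ.isOpen_schwingerMasses.mem_nhds hm] with z hz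
  exact (Γ.integralC_eq hC hz).symm

theorem IsRegular.lower {Γ : Family p L n} {ν : Fin p → ℂ} {D₀ : ℤ} {ε : ℂ}
    (hreg : Γ.IsRegular s ν (D₀ - 2 * ε)) : Γ.IsRegular s ν ((D₀ - 2 : ℤ) - 2 * ε) := by
  obtain ⟨C, hC⟩ := hreg
  refine ⟨C.lower, ?_⟩
  have := hC.lower
  rwa [show (D₀ : ℂ) - 2 * ε - 2 = ((D₀ - 2 : ℤ) : ℂ) - 2 * ε by push_cast; ring] at this

/-- The dimensional shift relation for complex squared masses. -/
theorem integralC_lower {ν : Fin p → ℤ} {D₀ : ℤ} {ε : ℂ}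
    (hreg : Γ.IsRegular s (fun j => (ν j : ℂ)) (D₀ - 2 * ε)) (hm : m ∈ Γ.schwingerMasses s) :
    Γ.integralC s ν (D₀ - 2) ε m = (-1) ^ L *
      polyDeriv ℂ (fun j => Pi.single j 1) Γ.symanzikU (Γ.integralC s ν D₀ ε) m := by
  obtain ⟨C, hC⟩ := hreg
  have hD : ((D₀ - 2 : ℤ) : ℂ) - 2 * ε = D₀ - 2 * ε - 2 := by push_cast; ring
  have hC' := hC.lower
  rw [← hD] at hC'
  have heq : Γ.integralC s ν D₀ ε =ᶠ[𝓝 m] fun z =>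
      Complex.exp (Real.eulerMascheroniConstant * L * ε) /
        C.den (fun j => (ν j : ℂ), D₀ - 2 * ε) * C.num (z, fun j => (ν j : ℂ), D₀ - 2 * ε) := by
    filter_upwards [Γ.isOpen_schwingerMasses.mem_nhds hm] with z hz
    exact Γ.integralC_eq hC hz
  rw [polyDeriv_comp (𝕜 := ℂ) (φ := fun z : Fin p → ℂ => (z, fun j => (ν j : ℂ), D₀ - 2 * ε))
      (b' := fun j => Pi.single j 1) (b := fun j => (Pi.single j 1, 0, 0)) (by fun_prop)
      (by simp) (C.num_analytic _ ⟨hm, hC.1, hC.2.1⟩) heq Γ.symanzikU,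
    Γ.integralC_eq hC' hm]
  simp only [Continuation.lower, hD, sub_add_cancel]
  ring

/-- At `θ = π/2` the factor `i` makes the real, mass independent part of `ℱ/𝒰` imaginary. The real
part left is `∑ j, -(m j).im * α j`, which decays at the rate of the least `-(m j).im`. -/
theorem mem_schwingerMasses_of_im_neg (hm : ∀ j, (m j).im < 0) : m ∈ Γ.schwingerMasses s := by
  obtain ⟨c, hc, h⟩ : ∃ c : ℝ, 0 < c ∧ ∀ j, c ≤ -(m j).im := by
    rcases isEmpty_or_nonempty (Fin p) with hp | hp
    · exact ⟨1, one_pos, fun j => isEmptyElim j⟩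
    · obtain ⟨j₀, hj₀⟩ := Finite.exists_min fun j => -(m j).im
      exact ⟨-(m j₀).im, by linarith [hm j₀], hj₀⟩
  refine ⟨Real.pi / 2, ⟨by positivity, le_rfl⟩, c, hc, fun α hα => ?_⟩
  have h0 := Γ.fullF_div_add s 0 m hα
  have hexp : Complex.exp (Complex.I * ((Real.pi / 2 : ℝ) : ℂ)) = Complex.I := by
    rw [mul_comm]
    push_cast
    exact Complex.exp_pi_div_two_mul_I
  have hreal : Γ.fullF s 0 α / (MvPolynomial.eval α Γ.symanzikU : ℂ) =
      ((MvPolynomial.eval α (Γ.symanzikF s) / MvPolynomial.eval α Γ.symanzikU : ℝ) : ℂ) := by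
    simp [fullF]
  rw [zero_add] at h0
  rw [hexp, h0, hreal, Complex.I_mul_re, Complex.add_im, Complex.ofReal_im, zero_add,
    Complex.im_sum, ← Finset.sum_neg_distrib, Finset.mul_sum]
  refine Finset.sum_le_sum fun j _ => ?_
  rw [Complex.im_mul_ofReal, ← neg_mul]
  exact mul_le_mul_of_nonneg_right (h j) (hα j).le

/-! ### Boundary values at real masses. -/

/-- The complex squared masses with negative imaginary parts. -/
def lowerMasses (p : ℕ) : Set (Fin p → ℂ) :=
  {z | ∀ j, (z j).im < 0}

theorem isOpen_lowerMasses : IsOpen (lowerMasses p) := by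
  unfold lowerMasses
  rw [Set.ofPred_forall]
  exact isOpen_iInter_of_finite fun j => isOpen_lt (by fun_prop) continuous_const

theorem continuous_ofReal_pi : Continuous fun (x : Fin p → ℝ) (j : Fin p) => (x j : ℂ) := by
  fun_prop

/-- The points `shifted y η` with `η > 0` lie in `lowerMasses`, and for `y` near `x` they end up
where `f = g`; continuity of `g` gives the limit. -/
theorem eventually_tendsto_shifted {f g : (Fin p → ℂ) → ℂ} {x : Fin p → ℝ}
    (hg : AnalyticAt ℂ g (fun j => (x j : ℂ)))
    (hfg : ∀ᶠ z in 𝓝[lowerMasses p] (fun j => (x j : ℂ)), f z = g z) :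
    ∀ᶠ y : Fin p → ℝ in 𝓝 x, Tendsto (fun η : ℝ => f (shifted y η)) (𝓝[>] 0)
      (𝓝 (g fun j => (y j : ℂ))) := by
  rw [eventually_nhdsWithin_iff] at hfg
  have h := continuous_ofReal_pi.continuousAt.eventually
    ((eventually_eventually_nhds.2 hfg).and hg.eventually_analyticAt)
  filter_upwards [h] with y hy
  have hs : Tendsto (fun η : ℝ => shifted y η) (𝓝[>] 0) (𝓝 fun j => (y j : ℂ)) := by
    have : Continuous fun η : ℝ => shifted y η := by
      unfold shifted
      fun_prop
    have h0 : shifted y 0 = fun j => (y j : ℂ) := by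
      ext j
      simp [shifted]
    exact (h0 ▸ this.tendsto 0).mono_left nhdsWithin_le_nhds
  refine (hy.2.continuousAt.tendsto.comp hs).congr' ?_
  filter_upwards [hs.eventually hy.1, self_mem_nhdsWithin] with η hη hpos
  refine (hη fun j => ?_).symm
  have : (0 : ℝ) < η := hpos
  simpa [shifted] using this

theorem analyticAt_comp_ofReal {g : (Fin p → ℂ) → ℂ} {x : Fin p → ℝ}
    (hg : AnalyticAt ℂ g (fun j => (x j : ℂ))) :
    AnalyticAt ℝ (fun y : Fin p → ℝ => g fun j => (y j : ℂ)) x := by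
  have h : AnalyticAt ℝ (fun (y : Fin p → ℝ) (j : Fin p) => (y j : ℂ)) x :=
    (ContinuousLinearMap.pi fun j =>
      Complex.ofRealCLM.comp (ContinuousLinearMap.proj (R := ℝ) j)).analyticAt x
  exact (hg.restrictScalars (𝕜 := ℝ)).fun_comp h

theorem diffOp_comp_ofReal {f : (Fin p → ℝ) → ℂ} {g : (Fin p → ℂ) → ℂ} {x : Fin p → ℝ}
    (hg : AnalyticAt ℂ g (fun j => (x j : ℂ)))
    (hf : f =ᶠ[𝓝 x] fun y => g fun j => (y j : ℂ)) (Q : MvPolynomial (Fin p) ℝ) :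
    diffOp Q f x = polyDeriv ℂ (fun j => Pi.single j 1) Q g (fun j => (x j : ℂ)) := by
  rw [diffOp_eq_polyDeriv, polyDeriv_comp (𝕜 := ℝ) (φ := fun (y : Fin p → ℝ) j => (y j : ℂ))
    (b' := fun j => Pi.single j 1) (b := fun j => Pi.single j 1) (c := 1) continuous_ofReal_pi
    ?_ hg (by simpa using hf), one_mul]
  intro j y t
  ext i
  by_cases h : i = j
  · subst h
    simp
  · simp [h]

end Family

end Feynman

end

theorem mainTheorem5 {p L n d : ℕ} (Γ : Feynman.Family p L n)
    (P : Fin n → Fin (d + 1) → ℝ) (ν : Fin p → ℤ) (D₀ : ℤ) (ε : ℂ)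
    (hreg : Γ.IsRegular (Feynman.scales P) (fun j => (ν j : ℂ)) (D₀ - 2 * ε)) :
    (Γ.IsRegular (Feynman.scales P) (fun j => (ν j : ℂ)) ((D₀ - 2 : ℤ) - 2 * ε)) ∧
    (∀ m : Fin p → ℝ, (∀ j, 0 < m j) →
      (fun j => (m j : ℂ)) ∈ Γ.schwingerMasses (Feynman.scales P) →
      Γ.GenericMasses (Feynman.scales P) ν D₀ ε m) ∧
    (∀ m : Fin p → ℝ, (∀ j, 0 < m j) → Γ.GenericMasses (Feynman.scales P) ν D₀ ε m →
      (∀ D ∈ ({D₀, D₀ - 2} : Set ℤ),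
        AnalyticAt ℝ (Γ.integral (Feynman.scales P) ν D ε) m ∧
        ∀ᶠ m' in 𝓝 m, Tendsto
          (fun η : ℝ => Γ.integralC (Feynman.scales P) ν D ε (Feynman.Family.shifted m' η))
          (𝓝[>] 0) (𝓝 (Γ.integral (Feynman.scales P) ν D ε m'))) ∧
      Γ.integral (Feynman.scales P) ν (D₀ - 2) ε m =
        (-1) ^ L * Feynman.diffOp Γ.symanzikU (Γ.integral (Feynman.scales P) ν D₀ ε) m) := by
  -- On `schwingerMasses` the integral is its own analytic extension.
  refine ⟨hreg.lower, fun m _ hm => ⟨_, Γ.analyticAt_integralC hreg hm,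
    Eventually.of_forall fun _ => rfl⟩, ?_⟩
  rintro m - ⟨g, hg, hgI⟩
  change ∀ᶠ z in 𝓝[Feynman.Family.lowerMasses p] _, _ at hgI
  set g₂ : (Fin p → ℂ) → ℂ := fun z =>
    (-1) ^ L * Feynman.polyDeriv ℂ (fun j => Pi.single j 1) Γ.symanzikU g z
  have hg₂ : AnalyticAt ℂ g₂ (fun j => (m j : ℂ)) := analyticAt_const.mul (hg.polyDeriv _ _)
  have hg₂I : ∀ᶠ z in 𝓝[Feynman.Family.lowerMasses p] (fun j => (m j : ℂ)),
      Γ.integralC (Feynman.scales P) ν (D₀ - 2) ε z = g₂ z := by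
    have hgz : ∀ᶠ z in 𝓝[Feynman.Family.lowerMasses p] (fun j => (m j : ℂ)), AnalyticAt ℂ g z :=
      hg.eventually_analyticAt.filter_mono nhdsWithin_le_nhds
    filter_upwards [eventually_eventually_nhdsWithin.2 hgI, hgz, self_mem_nhdsWithin]
      with z hz hgz hzm
    -- Openness turns equality within `lowerMasses` into equality of germs at `z`, so derivatives
    -- may be compared.
    rw [Feynman.Family.isOpen_lowerMasses.nhdsWithin_eq hzm] at hz
    rw [Γ.integralC_lower hreg (Γ.mem_schwingerMasses_of_im_neg hzm),
      Feynman.polyDeriv_congr hgz hz]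
  have hlim : ∀ (D : ℤ) (h : (Fin p → ℂ) → ℂ), AnalyticAt ℂ h (fun j => (m j : ℂ)) →
      (∀ᶠ z in 𝓝[Feynman.Family.lowerMasses p] (fun j => (m j : ℂ)),
        Γ.integralC (Feynman.scales P) ν D ε z = h z) →
      Γ.integral (Feynman.scales P) ν D ε =ᶠ[𝓝 m] (fun y => h fun j => (y j : ℂ)) ∧
      AnalyticAt ℝ (Γ.integral (Feynman.scales P) ν D ε) m ∧
        ∀ᶠ m' in 𝓝 m, Tendsto
          (fun η : ℝ => Γ.integralC (Feynman.scales P) ν D ε (Feynman.Family.shifted m' η))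
          (𝓝[>] 0) (𝓝 (Γ.integral (Feynman.scales P) ν D ε m')) := by
    intro D h hh hI
    have ht := Feynman.Family.eventually_tendsto_shifted hh hI
    have heq : Γ.integral (Feynman.scales P) ν D ε =ᶠ[𝓝 m] (fun y => h fun j => (y j : ℂ)) := by
      filter_upwards [ht] with y hy using hy.limUnder_eq
    refine ⟨heq, (Feynman.Family.analyticAt_comp_ofReal hh).congr heq.symm, ?_⟩
    filter_upwards [ht, heq] with y hy hy'
    rwa [hy']
  have h₁ := hlim D₀ g hg hgI
  have h₂ := hlim (D₀ - 2) g₂ hg₂ hg₂I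
  refine ⟨?_, ?_⟩
  · rintro D (rfl | rfl)
    exacts [h₁.2, h₂.2]
  · rw [h₂.1.eq_of_nhds, Feynman.Family.diffOp_comp_ofReal hg h₁.1]
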